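/- Let $B$ be a unital algebra over $\mathbb{C}$. A $B$-$B$-non-commutative probability space is a triple $(\mathcal{A},E,\varepsilon)$ where $\mathcal{A}$ is a unital algebra, $\varepsilon : B\otimes B^{\mathrm{op}}\to\mathcal{A}$ is a unital homomorphism that is injective on $B\otimes 1_B$ and on $1_B\otimes B^{\mathrm{op}}$, and $E:\mathcal{A}\to B$ is a linear map with $E(\varepsilon(b_1\otimes b_2)Z)=b_1E(Z)b_2$ and $E(Z\varepsilon(b\otimes 1))=E(Z\varepsilon(1\otimes b))$ for all $b,b_1,b_2\in B$ and $Z\in\mathcal{A}$. Write $L_b=\varepsilon(b\otimes 1)$, $R_b=\varepsilon(1\otimes b)$, and let $\mathcal{A}_\ell$ (respectively $\mathcal{A}_r$) be the algebra of the elements of $\mathcal{A}$ that commute with every $R_b$ (respectively every $L_b$). For $\chi:\{1,\dots,n\}\to\{\ell,r\}$ let $\prec_\chi$ be the total order on $\{1,\dots,n\}$ that lists $\chi^{-1}(\ell)$ increasingly and then $\chi^{-1}(r)$ decreasingly, let $BNC(\chi)$ be the set of partitions of $\{1,\dots,n\}$ that are non-crossing with respect to $\prec_\chi$, ordered by refinement,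 with Möbius function $\mu_{BNC}$ and largest element $1_\chi$. The moment function $E^B_\pi(Z_1,\dots,Z_n)\in B$, for $\pi\in BNC(\chi)$ and $Z_k\in\mathcal{A}_{\chi(k)}$, is the bi-multiplicative function with $E^B_{1_\chi}(Z_1,\dots,Z_n)=E(Z_1\cdots Z_n)$. It is computed by the following reduction, also for $\pi$ a non-crossing partition of a subset of the nodes. If $\pi$ has at least two blocks, let $V$ be the block whose $\prec_\chi$-last node comes first among the $\prec_\chi$-last nodes of all blocks, let $W$ be the union of the other blocks, and let $b=E(\prod_{k\in V}Z_k)$, the product being in increasing order of $k$. If no node of $W$ precedes $V$, then $E^B_\pi(Z)=b\,E^B_{\pi|_W}(Z|_W)$. Otherwise $E^B_\pi(Z)=E^B_{\pi|_W}(Z'|_W)$, where $Z'$ arises from $Z$ by replacing $Z_p$, for $p$ the $\prec_\chi$-last node of $W$ that precedes $V$, by $Z_pL_b$ if $\chi(p)=\ell$ and by $R_bZ_p$ if $\chi(p)=r$. The cumulants are $$\kappa^B_\chi(Z_1,\dots,Z_n)=\sum_{\sigma\in BNC(\chi)}\mu_{BNC}(\sigma,1_\chi)\,E^B_\sigma(Z_1,\dots,Z_n).$$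 Let $Z=\{Z_i\}_{i\in I}\sqcup\{Z_j\}_{j\in J}$ with $Z_i\in\mathcal{A}_\ell$ and $Z_j\in\mathcal{A}_r$, let $n\ge 1$ and $\omega:\{1,\dots,n\}\to I\sqcup J$, and put $\chi_\omega(k)=\ell$ if $\omega(k)\in I$ and $\chi_\omega(k)=r$ if $\omega(k)\in J$. Write $C^{k}_b=L_b$ if $\omega(k)\in I$ and $C^{k}_b=R_b$ if $\omega(k)\in J$. If $\omega$ takes values only in $I$ or only in $J$, define $$\kappa^B_{Z,\omega}(b_1,\dots,b_{n-1})=\kappa^B_{\chi_\omega}\big(Z_{\omega(1)},C^{2}_{b_1}Z_{\omega(2)},\dots,C^{n}_{b_{n-1}}Z_{\omega(n)}\big).$$ Otherwise let $k_0$ be the first index with $\chi_\omega(k_0)\ne\chi_\omega(1)$, and define $\kappa^B_{Z,\omega}(b_1,\dots,b_{n-1})$ as $\kappa^B_{\chi_\omega}$ of the tuple whose entries are $Z_{\omega(1)}$ at position $1$, $C^{k}_{b_{k-1}}Z_{\omega(k)}$ for $1<k<k_0$, $Z_{\omega(k_0)}$ at position $k_0$, and $C^{k}_{b_{k-2}}Z_{\omega(k)}$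 for $k>k_0$, where in addition the last entry is multiplied on the right by $C^{n}_{b_{n-1}}$. **Theorem.** Let $(\mathcal{A},E,\varepsilon)$ be a $B$-$B$-non-commutative probability space, let $D\subseteq B$ be a subalgebra with $1_B\in D$, and let $F:B\to D$ be a conditional expectation, that is, a linear map with $F(d)=d$ and $F(d_1bd_2)=d_1F(b)d_2$ for all $d,d_1,d_2\in D$ and $b\in B$. Let $\kappa^D$ denote the cumulants of the $D$-$D$-non-commutative probability space $(\mathcal{A},F\circ E,\varepsilon|_{D\otimes D^{\mathrm{op}}})$. Let $\{Z_i\}_{i\in I}\subseteq\mathcal{A}_\ell$ and $\{Z_j\}_{j\in J}\subseteq\mathcal{A}_r$. If $$\kappa^B_{Z,\omega}(d_1,\dots,d_{n-1})\in D$$ for all $n\ge1$, $\omega:\{1,\dots,n\}\to I\sqcup J$ and $d_1,\dots,d_{n-1}\in D$, then $$\kappa^D_{Z,\omega}(d_1,\dots,d_{n-1})=\kappa^B_{Z,\omega}(d_1,\dots,d_{n-1})$$ for all $n\ge1$, $\omega:\{1,\dots,n\}\to I\sqcup J$ and $d_1,\dots,d_{n-1}\in D$. -/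

import Mathlib

open scoped TensorProduct

namespace BiFree

/-! ### Left and right nodes, bi-non-crossing partitions -/

/-- The two sides: `left` is `ℓ`, `right` is `r`. -/
inductive Side
  | left
  | right
  deriving DecidableEq

/-- An order-preserving numbering for the order `≺_χ`: the left nodes come first, in increasing
order, and are followed by the right nodes, in decreasing order. -/
def chiPos {n : ℕ} (χ : Fin n → Side) (k : Fin n) : ℕ :=
  match χ k with
  | .left => k
  | .right => 2 * n - 1 - k

/-- The strict total order `≺_χ` on the nodes. -/
def ChiLT {n : ℕ} (χ : Fin n → Side) (j k : Fin n) : Prop := chiPos χ j < chiPos χ k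

/-- A partition is bi-non-crossing if no two distinct blocks cross with respect to `≺_χ`. -/
def IsBiNonCrossing {n : ℕ} (χ : Fin n → Side) {s : Finset (Fin n)} (π : Finpartition s) : Prop :=
  ∀ U ∈ π.parts, ∀ V ∈ π.parts, ∀ u₁ ∈ U, ∀ u₂ ∈ U, ∀ v₁ ∈ V, ∀ v₂ ∈ V,
    ChiLT χ u₁ v₁ → ChiLT χ v₁ u₂ → ChiLT χ u₂ v₂ → U = V

/-- The set `BNC(χ)`, ordered by refinement. -/
abbrev BNC {n : ℕ} (χ : Fin n → Side) : Type :=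
  {π : Finpartition (Finset.univ : Finset (Fin n)) // IsBiNonCrossing χ π}

/-- The one-block partition `1_χ`. -/
def BNC.one {n : ℕ} (χ : Fin n → Side) : BNC χ :=
  ⟨⊤, fun _ hU _ hV _ _ _ _ _ _ _ _ _ _ _ =>
    Finpartition.parts_top_subsingleton _ hU hV⟩

noncomputable instance {n : ℕ} (χ : Fin n → Side) : Fintype (BNC χ) :=
  Fintype.ofFinite _

open Classical in
noncomputable instance {n : ℕ} (χ : Fin n → Side) : LocallyFiniteOrder (BNC χ) :=
  Fintype.toLocallyFiniteOrder

open Classical in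
/-- The bi-non-crossing Möbius function: the Möbius function of the finite poset `BNC(χ)`. -/
noncomputable def muBNC {n : ℕ} (χ : Fin n → Side) (σ π : BNC χ) : ℂ :=
  IncidenceAlgebra.mu ℂ σ π

/-! ### `B`-`B`-non-commutative probability spaces -/

/-- A `B`-`B`-non-commutative probability space `(A, E, ε)`. -/
structure BBSpace (B A : Type*) [Ring B] [Algebra ℂ B] [Ring A] [Algebra ℂ A] where
  /-- The unital homomorphism `ε : B ⊗ B^op → A`. -/
  ε : B ⊗[ℂ] Bᵐᵒᵖ →ₐ[ℂ] A
  /-- The expectation. -/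
  E : A →ₗ[ℂ] B
  injective_left : Function.Injective fun b : B => ε (b ⊗ₜ[ℂ] 1)
  injective_right : Function.Injective fun b : Bᵐᵒᵖ => ε (1 ⊗ₜ[ℂ] b)
  E_mul (b₁ b₂ : B) (Z : A) : E (ε (b₁ ⊗ₜ[ℂ] MulOpposite.op b₂) * Z) = b₁ * E Z * b₂
  E_comm (b : B) (Z : A) :
    E (Z * ε (b ⊗ₜ[ℂ] 1)) = E (Z * ε (1 ⊗ₜ[ℂ] MulOpposite.op b))

section

variable {B A : Type*} [Ring B] [Algebra ℂ B] [Ring A] [Algebra ℂ A]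

namespace BBSpace

/-- `L_b = ε(b ⊗ 1)`. -/
def L (P : BBSpace B A) (b : B) : A := P.ε (b ⊗ₜ[ℂ] 1)

/-- `R_b = ε(1 ⊗ b)`. -/
def R (P : BBSpace B A) (b : B) : A := P.ε (1 ⊗ₜ[ℂ] MulOpposite.op b)

/-- The left algebra: the elements that commute with every `R_b`. -/
def leftAlgebra (P : BBSpace B A) : Subalgebra ℂ A :=
  Subalgebra.centralizer ℂ (Set.range P.R)

/-- The right algebra: the elements that commute with every `L_b`. -/
def rightAlgebra (P : BBSpace B A) : Subalgebra ℂ A :=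
  Subalgebra.centralizer ℂ (Set.range P.L)

/-- `L_b` on the left side and `R_b` on the right side. -/
def C (P : BBSpace B A) : Side → B → A
  | .left => P.L
  | .right => P.R

end BBSpace

/-! ### Moment and cumulant functions -/

/-- The product `Z_{v₁} ⋯ Z_{v_m}` over the nodes `v₁ < ⋯ < v_m` of `V`, in their usual order. -/
def orderedProd {n : ℕ} (Z : Fin n → A) (V : Finset (Fin n)) : A :=
  ((V.sort (· ≤ ·)).map Z).prod

/-- `V` is the block of `π` whose `≺_χ`-last node precedes the `≺_χ`-last node of each other
block. If `π` is bi-non-crossing, `V` is an interval of the underlying set of `π` for `≺_χ`. -/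
def ClosesFirst {n : ℕ} (χ : Fin n → Side) {s : Finset (Fin n)} (π : Finpartition s)
    (V : Finset (Fin n)) : Prop :=
  V ∈ π.parts ∧ ∀ U ∈ π.parts, U ≠ V → ∃ u ∈ U, ∀ v ∈ V, ChiLT χ v u

/-- `p` is the `≺_χ`-last of the elements of `W` that precede all of `V`. -/
def IsPred {n : ℕ} (χ : Fin n → Side) (V W : Finset (Fin n)) (p : Fin n) : Prop :=
  (p ∈ W ∧ ∀ v ∈ V, ChiLT χ p v) ∧
    ∀ k ∈ W, (∀ v ∈ V, ChiLT χ k v) → k = p ∨ ChiLT χ k p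

open Classical in
/-- The tuple `Z` in which `Z_p` is replaced by `Z_p L_b` (if `p` is a left node) or by `R_b Z_p`
(if `p` is a right node), where `p` is the `≺_χ`-predecessor of `V` in `W`. -/
noncomputable def insertAtPred (P : BBSpace B A) {n : ℕ} (χ : Fin n → Side)
    (V W : Finset (Fin n)) (b : B) (Z : Fin n → A) (k : Fin n) : A :=
  if IsPred χ V W k then
    match χ k with
    | .left => Z k * P.L b
    | .right => P.R b * Z k
  else Z k

open Classical in
/-- The operator-valued bi-free moment function `E_π`, for a partition `π` of a set `s` of nodes.

It is the bi-multiplicative function with `E_{1_χ}(Z_1, …, Z_n) = E(Z_1 ⋯ Z_n)`, and each step of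
the recursion is one of the reductions by which bi-multiplicativity determines `E_π`. With `V` the
interval block that closes first, `W` the union of the other blocks and `b = E_V(Z|_V)`:

* if no node precedes `V`, then `V` and `W` are consecutive intervals, and
  `E_π(Z) = b * E_{π|_W}(Z|_W)`;
* otherwise the first and the last node lie in `W`, and `b` is moved into the entry of the
  predecessor `p` of `V`, as `Z_p L_b` or `R_b Z_p`. -/
noncomputable def momentOn (P : BBSpace B A) {n : ℕ} (χ : Fin n → Side)
    (s : Finset (Fin n)) (π : Finpartition s) (Z : Fin n → A) : B :=
  if h : ∃ V, ClosesFirst χ π V ∧ V ≠ s then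
    if ∃ p ∈ s \ h.choose, ∀ v ∈ h.choose, ChiLT χ p v then
      momentOn P χ (s \ h.choose) (π.avoid h.choose)
        (insertAtPred P χ h.choose (s \ h.choose) (P.E (orderedProd Z h.choose)) Z)
    else
      P.E (orderedProd Z h.choose) * momentOn P χ (s \ h.choose) (π.avoid h.choose) Z
  else
    P.E (orderedProd Z s)
termination_by s.card
decreasing_by
  all_goals
    refine Finset.card_lt_card (Finset.sdiff_ssubset (π.le h.choose_spec.1.1) ?_)
    exact π.nonempty_of_mem_parts h.choose_spec.1.1

/-- The moment function `E_π(Z_1, …, Z_n)` for `π ∈ BNC(χ)`. -/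
noncomputable def moment (P : BBSpace B A) {n : ℕ} (χ : Fin n → Side) (π : BNC χ)
    (Z : Fin n → A) : B :=
  momentOn P χ Finset.univ π.1 Z

open Classical in
/-- The operator-valued bi-free cumulant function `κ_π(Z_1, …, Z_n)`. -/
noncomputable def cumulant (P : BBSpace B A) {n : ℕ} (χ : Fin n → Side) (π : BNC χ)
    (Z : Fin n → A) : B :=
  ∑ σ : BNC χ with σ ≤ π, muBNC χ σ π • moment P χ σ Z

/-! ### The cumulants of a two-faced family -/

/-- The side of an index in `I ⊔ J`. -/
def sideOf {I J : Type*} : I ⊕ J → Side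
  | .inl _ => .left
  | .inr _ => .right

/-- `χ_ω`. -/
def chiOf {I J : Type*} {n : ℕ} (ω : Fin n → I ⊕ J) (k : Fin n) : Side := sideOf (ω k)

open Classical in
/-- The `k`-th argument of `κ_{Z,ω}(b_1, …, b_{n-1})`, where `n = m + 1` and nodes and the `b`'s are
numbered from `0`. There is no factor `C_b` in front of `Z_{ω(k)}` if `k` is the first node on its
side. In front of the other nodes the `b`'s are used up in order; so the node `k` receives number
`k - 1` as long as all nodes before it lie on the side of node `0`, and number `k - 2` afterwards.
If both sides occur, the last `b` is put to the right of the last argument. -/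
noncomputable def kappaArg (P : BBSpace B A) {I J : Type*} (Z : I ⊕ J → A) {m : ℕ}
    (ω : Fin (m + 1) → I ⊕ J) (b : Fin m → B) (k : Fin (m + 1)) : A :=
  (if h : ∃ j < k, chiOf ω j = chiOf ω k then
      P.C (chiOf ω k) (b ⟨if ∃ j < k, chiOf ω j ≠ chiOf ω 0 then k - 2 else k - 1, by
        obtain ⟨j, hj, -⟩ := h
        have hj' : j.val < k.val := hj
        have hk := k.isLt
        split_ifs <;> omega⟩)
    else 1) *
  Z (ω k) *
  (if h : k = Fin.last m ∧ ∃ j, chiOf ω j ≠ chiOf ω 0 then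
      P.C (chiOf ω k) (b ⟨m - 1, by
        obtain ⟨-, j, hj⟩ := h
        have h0 : j ≠ 0 := fun h => hj (by rw [h])
        have h1 := Fin.val_ne_of_ne h0
        have h2 := j.isLt
        simp only [Fin.val_zero] at h1
        omega⟩)
    else 1)

/-- `κ_{Z,ω}(b_1, …, b_{n-1})` with `n = m + 1`. -/
noncomputable def kappa (P : BBSpace B A) {I J : Type*} (Z : I ⊕ J → A) {m : ℕ}
    (ω : Fin (m + 1) → I ⊕ J) (b : Fin m → B) : B :=
  cumulant P (chiOf ω) (BNC.one (chiOf ω)) (kappaArg P Z ω b)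

/-! ### Passing to a subalgebra -/

/-- A conditional expectation of `B` onto the unital subalgebra `D`. -/
structure CondExp (D : Subalgebra ℂ B) where
  /-- The underlying linear map. -/
  F : B →ₗ[ℂ] D
  F_coe (d : D) : F d = d
  F_mul (d₁ d₂ : D) (b : B) : F (d₁ * b * d₂) = d₁ * F b * d₂

/-- The `D`-`D`-non-commutative probability space `(A, F ∘ E, ε|_{D ⊗ D^op})`. -/
noncomputable def BBSpace.restrict (P : BBSpace B A) {D : Subalgebra ℂ B} (F : CondExp D) :
    BBSpace D A where
  ε := P.ε.comp (Algebra.TensorProduct.map D.val (AlgHom.op D.val))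
  E := F.F ∘ₗ P.E
  injective_left d₁ d₂ h := by
    apply Subtype.ext
    apply P.injective_left
    simpa using h
  injective_right d₁ d₂ h := by
    have h' := P.injective_right (a₁ := MulOpposite.op (d₁.unop : B))
      (a₂ := MulOpposite.op (d₂.unop : B)) (by simpa using h)
    exact MulOpposite.unop_injective (Subtype.ext (MulOpposite.op_injective h'))
  E_mul d₁ d₂ Z := by
    have h := P.E_mul d₁ d₂ Z
    simp only [AlgHom.comp_apply, Algebra.TensorProduct.map_tmul, LinearMap.comp_apply]
    rw [← F.F_mul, ← h]
    rfl
  E_comm d Z := by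
    have h := P.E_comm d Z
    simp only [AlgHom.comp_apply, Algebra.TensorProduct.map_tmul, LinearMap.comp_apply, map_one]
    exact congrArg F.F h

end

end BiFree

/-! A cumulant is a combination of moments `E_σ` with coefficients that do not depend on the space,
and each `E_σ` is built recursively from values of `E` on products over blocks. Since `F` fixes `D`,
the two cumulants agree term by term once every such value lies in `D` (`momentOn_restrict`).

The recursion inserts earlier values into later entries, so the statement to prove is stronger: `E`
of any product of entries `C_p Z C_q` with `p, q ∈ D` lies in `D` (`E_prod_mem`). This goes by
induction on the length. The commutation relations and the bimodule property of `E` reduce the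
product, up to outer factors in `D`, to the arguments of some `κ^B_{Z,ω}(d)` (`exists_normalProd`,
`exists_E_prod_eq`). The moment of these arguments is that cumulant, in `D` by hypothesis, minus
multiples of moments `E_σ` with `σ ≠ 1_χ`; those only involve shorter products (`momentOn_mem`). -/

namespace BiFree

section

variable {B A : Type*} [Ring B] [Algebra ℂ B] [Ring A] [Algebra ℂ A]

/-! ### Calculus of `L`, `R` and `E`, and compatibility with `restrict` -/

namespace BBSpace

variable (P : BBSpace B A)

@[simp]
theorem L_one : P.L 1 = 1 := by
  simp [L, ← Algebra.TensorProduct.one_def]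

@[simp]
theorem R_one : P.R 1 = 1 := by
  simp [R, ← Algebra.TensorProduct.one_def]

theorem L_mul_L (a b : B) : P.L a * P.L b = P.L (a * b) := by
  simp [L, ← map_mul]

theorem R_mul_R (a b : B) : P.R a * P.R b = P.R (b * a) := by
  simp [R, ← map_mul]

theorem commute_L_R (a b : B) : Commute (P.L a) (P.R b) := by
  simp [Commute, SemiconjBy, L, R, ← map_mul]

theorem E_L_mul (a : B) (X : A) : P.E (P.L a * X) = a * P.E X := by
  simpa [L] using P.E_mul a 1 X

theorem E_R_mul (a : B) (X : A) : P.E (P.R a * X) = P.E X * a := by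
  simpa [R] using P.E_mul 1 a X

theorem E_mul_L (a : B) (X : A) : P.E (X * P.L a) = P.E (X * P.R a) :=
  P.E_comm a X

@[simp]
theorem C_one (s : Side) : P.C s 1 = 1 := by
  cases s <;> simp [C]

@[simp]
theorem restrict_L {D : Subalgebra ℂ B} (F : CondExp D) (d : D) :
    (P.restrict F).L d = P.L d := by
  simp [L, restrict]

@[simp]
theorem restrict_R {D : Subalgebra ℂ B} (F : CondExp D) (d : D) :
    (P.restrict F).R d = P.R d := by
  simp [R, restrict]

@[simp]
theorem restrict_C {D : Subalgebra ℂ B} (F : CondExp D) (s : Side) (d : D) :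
    (P.restrict F).C s d = P.C s d := by
  cases s <;> simp [C]

theorem restrict_E {D : Subalgebra ℂ B} (F : CondExp D) {X : A} (hX : P.E X ∈ D) :
    ((P.restrict F).E X : B) = P.E X :=
  congrArg Subtype.val (F.F_coe ⟨P.E X, hX⟩)

end BBSpace

/-! ### Entries decorated with elements of a subalgebra -/

/-- `X` is of the form `C_p Y C_q` with `p, q ∈ D`. -/
def IsDecorated (P : BBSpace B A) (D : Subalgebra ℂ B) (s : Side) (Y X : A) : Prop :=
  ∃ p ∈ D, ∃ q ∈ D, X = P.C s p * Y * P.C s q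

theorem IsDecorated.mul_L {P : BBSpace B A} {D : Subalgebra ℂ B} {Y X : A}
    (h : IsDecorated P D .left Y X) {b : B} (hb : b ∈ D) :
    IsDecorated P D .left Y (X * P.L b) := by
  obtain ⟨p, hp, q, hq, rfl⟩ := h
  exact ⟨p, hp, q * b, mul_mem hq hb, by simp only [BBSpace.C, ← P.L_mul_L, mul_assoc]⟩

theorem IsDecorated.R_mul {P : BBSpace B A} {D : Subalgebra ℂ B} {Y X : A}
    (h : IsDecorated P D .right Y X) {b : B} (hb : b ∈ D) :
    IsDecorated P D .right Y (P.R b * X) := by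
  obtain ⟨p, hp, q, hq, rfl⟩ := h
  -- `R` reverses products: `R_b R_p = R_{pb}`.
  exact ⟨p * b, mul_mem hp hb, q, hq, by simp only [BBSpace.C, ← P.R_mul_R, mul_assoc]⟩

/-- Left nodes absorb `b` on the right and right nodes on the left; allowing factors on both sides
makes decorated entries stable under the moment recursion. -/
theorem isDecorated_insertAtPred {P : BBSpace B A} {D : Subalgebra ℂ B} {n : ℕ}
    {χ : Fin n → Side} {Y X : Fin n → A} (h : ∀ k, IsDecorated P D (χ k) (Y k) (X k))
    (V W : Finset (Fin n)) {b : B} (hb : b ∈ D) (k : Fin n) :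
    IsDecorated P D (χ k) (Y k) (insertAtPred P χ V W b X k) := by
  have hk := h k
  unfold insertAtPred
  split_ifs
  · cases hs : χ k <;> rw [hs] at hk
    · exact hk.mul_L hb
    · exact hk.R_mul hb
  · exact hk

theorem isDecorated_kappaArg {P : BBSpace B A} {D : Subalgebra ℂ B} {I J : Type*}
    (Z : I ⊕ J → A) {m : ℕ} (ω : Fin (m + 1) → I ⊕ J) {b : Fin m → B} (hb : ∀ i, b i ∈ D)
    (k : Fin (m + 1)) : IsDecorated P D (chiOf ω k) (Z (ω k)) (kappaArg P Z ω b k) := by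
  unfold kappaArg
  by_cases h : ∃ j < k, chiOf ω j = chiOf ω k <;>
    by_cases h' : k = Fin.last m ∧ ∃ j, chiOf ω j ≠ chiOf ω 0
  · rw [dif_pos h, dif_pos h']
    exact ⟨_, hb _, _, hb _, rfl⟩
  · rw [dif_pos h, dif_neg h']
    exact ⟨_, hb _, 1, one_mem D, by rw [P.C_one]⟩
  · rw [dif_neg h, dif_pos h']
    exact ⟨1, one_mem D, _, hb _, by rw [P.C_one]⟩
  · rw [dif_neg h, dif_neg h']
    exact ⟨1, one_mem D, 1, one_mem D, by rw [P.C_one]⟩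

/-! ### Moments along a partition -/

theorem orderedProd_eq_ofFn {A : Type*} [Ring A] {n N : ℕ} (Z : Fin n → A) (V : Finset (Fin n)) (h : V.card = N) :
    orderedProd Z V = (List.ofFn fun i => Z (V.orderEmbOfFin h i)).prod := by
  subst h
  unfold orderedProd
  congr 1
  apply List.ext_getElem
  · simp
  · intro i h₁ h₂
    simp [Finset.orderEmbOfFin_apply]

theorem orderedProd_univ {A : Type*} [Ring A] {n : ℕ} (Z : Fin n → A) :
    orderedProd Z Finset.univ = (List.ofFn Z).prod := by
  rw [orderedProd_eq_ofFn Z Finset.univ (Finset.card_fin n)]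
  congr 2
  funext i
  have h := Finset.orderEmbOfFin_unique (Finset.card_fin n)
    (fun x => Finset.mem_univ (id x)) strictMono_id
  rw [← h, id]

theorem chiPos_injective {n : ℕ} (χ : Fin n → Side) : Function.Injective (chiPos χ) := by
  intro j k h
  have hj := j.isLt
  have hk := k.isLt
  unfold chiPos at h
  apply Fin.ext
  split at h <;> split at h <;> omega

/-- Minimize the last position over the blocks; distinct blocks are disjoint, so there is no tie. -/
theorem exists_closesFirst {n : ℕ} (χ : Fin n → Side) {s : Finset (Fin n)} (hs : s.Nonempty)
    (π : Finpartition s) : ∃ V, ClosesFirst χ π V := by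
  have hne : π.parts.Nonempty := π.parts_nonempty hs.ne_empty
  obtain ⟨V, hV, hmin⟩ := π.parts.exists_min_image (fun U => U.sup (chiPos χ)) hne
  refine ⟨V, hV, fun U hU hUV => ?_⟩
  obtain ⟨u, hu, hu'⟩ := U.exists_mem_eq_sup (π.nonempty_of_mem_parts hU) (chiPos χ)
  refine ⟨u, hu, fun v hv => ?_⟩
  have hle : chiPos χ v ≤ chiPos χ u :=
    (Finset.le_sup hv).trans ((hmin U hU).trans hu'.le)
  refine lt_of_le_of_ne hle fun h => ?_
  have huv := chiPos_injective χ h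
  subst huv
  exact hUV (π.eq_of_mem_parts hU hV hu hv)

theorem exists_closesFirst_ne {n : ℕ} (χ : Fin n → Side) {s : Finset (Fin n)} (hs : s.Nonempty)
    {π : Finpartition s} (hπ : π ≠ ⊤) : ∃ V, ClosesFirst χ π V ∧ V ≠ s := by
  obtain ⟨V, hV⟩ := exists_closesFirst χ hs π
  refine ⟨V, hV, ?_⟩
  rintro rfl
  refine hπ (top_le_iff.1 fun U hU => ⟨V, hV.1, ?_⟩)
  exact (⊤ : Finpartition V).le hU

theorem momentOn_top (P : BBSpace B A) {n : ℕ} (χ : Fin n → Side) (s : Finset (Fin n))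
    (X : Fin n → A) : momentOn P χ s ⊤ X = P.E (orderedProd X s) := by
  rw [momentOn, dif_neg]
  rintro ⟨V, hV, hne⟩
  exact hne (Finset.mem_singleton.1 (Finpartition.parts_top_subset s hV.1))

/-- If the moments of the nonempty proper subsets of the nodes lie in `D` for all decorated
entries, then so do the moments along all partitions other than the one-block partition. -/
theorem momentOn_mem {P : BBSpace B A} {D : Subalgebra ℂ B} {n : ℕ} {χ : Fin n → Side}
    {Y : Fin n → A}
    (hE : ∀ X : Fin n → A, (∀ k, IsDecorated P D (χ k) (Y k) (X k)) →
      ∀ V : Finset (Fin n), V.Nonempty → V ≠ Finset.univ → P.E (orderedProd X V) ∈ D)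
    (s : Finset (Fin n)) (hs : s.Nonempty) (π : Finpartition s)
    (hπ : s ≠ Finset.univ ∨ π ≠ ⊤) (X : Fin n → A)
    (hX : ∀ k, IsDecorated P D (χ k) (Y k) (X k)) : momentOn P χ s π X ∈ D := by
  induction hN : s.card using Nat.strong_induction_on generalizing s X with
  | _ N ih =>
  subst hN
  rw [momentOn]
  split_ifs with h h'
  -- In the last goal `h` is a negation and the block of facts does not apply.
  all_goals try
    have hV := h.choose_spec.1.1
    have hVs : h.choose ⊆ s := π.le hV
    have hVne := π.nonempty_of_mem_parts hV
    have hss : h.choose ⊂ s := lt_of_le_of_ne hVs h.choose_spec.2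
    have hVu : h.choose ≠ Finset.univ := fun hu =>
      hss.2 (hu ▸ Finset.subset_univ s)
    have hb := hE X hX _ hVne hVu
    have hlt : s \ h.choose ⊂ s := Finset.sdiff_ssubset hVs hVne
    have hWne : (s \ h.choose).Nonempty := Finset.sdiff_nonempty.2 hss.2
    have hWu : s \ h.choose ≠ Finset.univ := fun hu => hlt.2 (hu ▸ Finset.subset_univ s)
  · exact ih _ (Finset.card_lt_card hlt) _ hWne _ (Or.inl hWu) _
      (isDecorated_insertAtPred hX _ _ hb) rfl
  · exact mul_mem hb (ih _ (Finset.card_lt_card hlt) _ hWne _ (Or.inl hWu) _ hX rfl)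
  · refine hE X hX s hs ?_
    rcases hπ with hπ | hπ
    · exact hπ
    · exact absurd (exists_closesFirst_ne χ hs hπ) h

theorem insertAtPred_restrict (P : BBSpace B A) {D : Subalgebra ℂ B} (F : CondExp D) {n : ℕ}
    (χ : Fin n → Side) (V W : Finset (Fin n)) (b : D) (X : Fin n → A) :
    insertAtPred (P.restrict F) χ V W b X = insertAtPred P χ V W (b : B) X := by
  funext k
  simp [insertAtPred]

/-- Which block is removed depends only on `χ` and `π`, so both recursions run in parallel, and each
value of `E` they meet lies in `D`, where `F` is the identity. -/
theorem momentOn_restrict {P : BBSpace B A} {D : Subalgebra ℂ B} (F : CondExp D) {n : ℕ}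
    {χ : Fin n → Side} {Y : Fin n → A}
    (hE : ∀ X : Fin n → A, (∀ k, IsDecorated P D (χ k) (Y k) (X k)) →
      ∀ V : Finset (Fin n), V.Nonempty → P.E (orderedProd X V) ∈ D)
    (s : Finset (Fin n)) (hs : s.Nonempty) (π : Finpartition s) (X : Fin n → A)
    (hX : ∀ k, IsDecorated P D (χ k) (Y k) (X k)) :
    ((momentOn (P.restrict F) χ s π X : D) : B) = momentOn P χ s π X := by
  induction hN : s.card using Nat.strong_induction_on generalizing s X with
  | _ N ih =>
  subst hN
  rw [momentOn, momentOn]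
  split_ifs with h h'
  all_goals try
    have hV := h.choose_spec.1.1
    have hVs : h.choose ⊆ s := π.le hV
    have hVne := π.nonempty_of_mem_parts hV
    have hss : h.choose ⊂ s := lt_of_le_of_ne hVs h.choose_spec.2
    have hb := hE X hX _ hVne
    have hlt : s \ h.choose ⊂ s := Finset.sdiff_ssubset hVs hVne
    have hWne : (s \ h.choose).Nonempty := Finset.sdiff_nonempty.2 hss.2
  · rw [insertAtPred_restrict, P.restrict_E F hb]
    exact ih _ (Finset.card_lt_card hlt) _ hWne _ _ (isDecorated_insertAtPred hX _ _ hb) rfl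
  · rw [MulMemClass.coe_mul, P.restrict_E F hb,
      ih _ (Finset.card_lt_card hlt) _ hWne _ _ hX rfl]
  · exact P.restrict_E F (hE X hX s hs)

/-! ### Normal form of decorated products -/

open Classical in
/-- The entry `C_c Z_{ω(k)}`, without the factor `C_c` if `k` is the first node on its side. -/
noncomputable def normalEntry (P : BBSpace B A) {I J : Type*} (Z : I ⊕ J → A) {n : ℕ}
    (ω : Fin n → I ⊕ J) (c : Fin n → B) (k : Fin n) : A :=
  (if ∃ j < k, chiOf ω j = chiOf ω k then P.C (chiOf ω k) (c k) else 1) * Z (ω k)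

section

variable {I J : Type*} {P : BBSpace B A} {Z : I ⊕ J → A}

theorem commute_C_L {s : Side} (hs : s = .right) (a b : B) : Commute (P.C s a) (P.L b) := by
  subst hs
  exact (P.commute_L_R b a).symm

theorem commute_C_R {s : Side} (hs : s = .left) (a b : B) : Commute (P.C s a) (P.R b) := by
  subst hs
  exact P.commute_L_R a b

/-- Lets the decoration of the first left node travel to the front past a prefix of right nodes. -/
theorem commute_normalProd_L (hr : ∀ j b, Commute (Z (.inr j)) (P.L b)) {n : ℕ}
    (ω : Fin n → I ⊕ J) (hω : ∀ k, chiOf ω k = .right) (c : Fin n → B) (b : B) :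
    Commute (List.ofFn (normalEntry P Z ω c)).prod (P.L b) := by
  refine Commute.list_prod_left _ _ fun x hx => ?_
  obtain ⟨k, rfl⟩ := List.mem_ofFn.1 hx
  refine Commute.mul_left ?_ ?_
  · split_ifs
    · exact commute_C_L (hω k) _ _
    · exact Commute.one_left _
  · have hk := hω k
    unfold chiOf sideOf at hk
    rcases hk' : ω k with i | j
    · simp [hk'] at hk
    · exact hr j b

theorem commute_normalProd_R (hl : ∀ i b, Commute (Z (.inl i)) (P.R b)) {n : ℕ}
    (ω : Fin n → I ⊕ J) (hω : ∀ k, chiOf ω k = .left) (c : Fin n → B) (b : B) :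
    Commute (List.ofFn (normalEntry P Z ω c)).prod (P.R b) := by
  refine Commute.list_prod_left _ _ fun x hx => ?_
  obtain ⟨k, rfl⟩ := List.mem_ofFn.1 hx
  refine Commute.mul_left ?_ ?_
  · split_ifs
    · exact commute_C_R (hω k) _ _
    · exact Commute.one_left _
  · have hk := hω k
    unfold chiOf sideOf at hk
    rcases hk' : ω k with i | j
    · exact hl i b
    · simp [hk'] at hk

theorem normalProd_succ {n : ℕ} (ω : Fin (n + 1) → I ⊕ J) (c : Fin n → B) (x : B) :
    (List.ofFn (normalEntry P Z ω (Fin.snoc (α := fun _ => B) c x))).prod =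
      (List.ofFn (normalEntry P Z (fun k => ω k.castSucc) c)).prod *
        normalEntry P Z ω (Fin.snoc (α := fun _ => B) c x) (Fin.last n) := by
  rw [List.ofFn_succ', List.concat_eq_append, List.prod_append, List.prod_singleton]
  congr 3
  funext k
  have h : (∃ j < k.castSucc, chiOf ω j = chiOf ω k.castSucc) ↔
      ∃ j < k, chiOf (fun k => ω k.castSucc) j = chiOf (fun k => ω k.castSucc) k := by
    constructor
    · rintro ⟨j, hj, h⟩
      have hj' : j.val < k.val := hj
      exact ⟨⟨j, hj'.trans k.isLt⟩, hj, h⟩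
    · rintro ⟨j, hj, h⟩
      exact ⟨j.castSucc, hj, h⟩
  simp only [normalEntry, h, Fin.snoc_castSucc]
  rfl

theorem normalEntry_last_of_exists {n : ℕ} (ω : Fin (n + 1) → I ⊕ J) (c : Fin (n + 1) → B)
    (h : ∃ j : Fin n, chiOf ω j.castSucc = chiOf ω (Fin.last n)) :
    normalEntry P Z ω c (Fin.last n) =
      P.C (chiOf ω (Fin.last n)) (c (Fin.last n)) * Z (ω (Fin.last n)) := by
  obtain ⟨j, hj⟩ := h
  rw [normalEntry, if_pos ⟨j.castSucc, Fin.castSucc_lt_last j, hj⟩]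

theorem normalEntry_last_of_forall {n : ℕ} (ω : Fin (n + 1) → I ⊕ J) (c : Fin (n + 1) → B)
    (h : ∀ j : Fin n, chiOf ω j.castSucc ≠ chiOf ω (Fin.last n)) :
    normalEntry P Z ω c (Fin.last n) = Z (ω (Fin.last n)) := by
  rw [normalEntry, if_neg, one_mul]
  rintro ⟨j, hj, hside⟩
  obtain ⟨i, rfl⟩ := Fin.exists_castSucc_eq.2 hj.ne
  exact h i hside

/-- A product of decorated entries can be rewritten with decorations only at the two ends and in
front of the entries that are not the first on their side. -/
theorem exists_normalProd {D : Subalgebra ℂ B}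
    (hl : ∀ i b, Commute (Z (.inl i)) (P.R b)) (hr : ∀ j b, Commute (Z (.inr j)) (P.L b))
    {n : ℕ} (ω : Fin n → I ⊕ J) (X : Fin n → A)
    (hX : ∀ k, IsDecorated P D (chiOf ω k) (Z (ω k)) (X k)) :
    ∃ c : Fin n → B, (∀ k, c k ∈ D) ∧ ∃ a ∈ D, ∃ a' ∈ D, ∃ b ∈ D, ∃ b' ∈ D,
      ((∀ k, chiOf ω k = .right) → a = 1 ∧ b = 1) ∧
      ((∀ k, chiOf ω k = .left) → a' = 1 ∧ b' = 1) ∧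
      (List.ofFn X).prod =
        P.L a * (P.R a' * ((List.ofFn (normalEntry P Z ω c)).prod * (P.L b * P.R b'))) := by
  induction n with
  | zero =>
    exact ⟨fun _ => 1, fun _ => one_mem D, 1, one_mem D, 1, one_mem D, 1, one_mem D, 1, one_mem D,
      by simp⟩
  | succ n ih =>
    obtain ⟨c, hc, a, ha, a', ha', b, hb, b', hb', hright, hleft, hprod⟩ :=
      ih (fun k => ω k.castSucc) (fun k => X k.castSucc) fun k => hX k.castSucc
    have hsnoc : ∀ x ∈ D, ∀ k, (Fin.snoc (α := fun _ => B) c x : Fin (n + 1) → B) k ∈ D := by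
      intro x hx k
      refine Fin.lastCases ?_ (fun i => ?_) k
      · simpa using hx
      · simpa using hc i
    obtain ⟨p, hp, q, hq, hXl⟩ := hX (Fin.last n)
    rw [List.ofFn_succ', List.concat_eq_append, List.prod_append, List.prod_singleton, hprod, hXl]
    set W := (List.ofFn (normalEntry P Z (fun k => ω k.castSucc) c)).prod with hW
    rcases hω : ω (Fin.last n) with i | j
    · have hs : chiOf ω (Fin.last n) = .left := by simp [chiOf, sideOf, hω]
      have hnr : ¬ ∀ k, chiOf ω k = .right := fun h => by simpa [hs] using h (Fin.last n)
      have hleft' : (∀ k, chiOf ω k = .left) → a' = 1 ∧ b' = 1 := fun h =>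
        hleft fun k => h k.castSucc
      have hR : Commute (P.R b') (P.L p * Z (.inl i) * P.L q) :=
        (((P.commute_L_R p b').mul_left (hl i b')).mul_left (P.commute_L_R q b')).symm
      by_cases h : ∃ j : Fin n, chiOf ω j.castSucc = chiOf ω (Fin.last n)
      · refine ⟨Fin.snoc (α := fun _ => B) c (b * p), hsnoc _ (mul_mem hb hp), a, ha, a', ha',
          q, hq, b', hb', fun h => absurd h hnr, hleft', ?_⟩
        rw [normalProd_succ, normalEntry_last_of_exists _ _ h, hs, hω, Fin.snoc_last, ← hW]
        simp only [BBSpace.C, mul_assoc, ← P.L_mul_L] at hR ⊢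
        rw [hR.eq]
        simp only [mul_assoc]
      · push Not at h
        have hall : ∀ k : Fin n, chiOf (fun k => ω k.castSucc) k = .right := by
          intro k
          have := h k
          rw [hs] at this
          show chiOf ω k.castSucc = .right
          cases hk : chiOf ω k.castSucc
          · exact absurd hk this
          · rfl
        -- The prefix has only right nodes, so the invariant leaves both left outer slots empty: `p`
        -- goes to the front and `q` to the end.
        obtain ⟨rfl, rfl⟩ := hright hall
        have hWL := commute_normalProd_L (P := P) (Z := Z) hr _ hall c p
        rw [← hW] at hWL
        refine ⟨Fin.snoc (α := fun _ => B) c 1, hsnoc _ (one_mem D), p, hp, a', ha',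
          q, hq, b', hb', fun h => absurd h hnr, hleft', ?_⟩
        rw [normalProd_succ, normalEntry_last_of_forall _ _ h, hs, hω, ← hW]
        simp only [BBSpace.C, P.L_one, one_mul, mul_assoc] at hR ⊢
        rw [hR.eq, (P.commute_L_R p a').left_comm, ← hWL.left_comm]
        simp only [mul_assoc]
    · have hs : chiOf ω (Fin.last n) = .right := by simp [chiOf, sideOf, hω]
      have hnl : ¬ ∀ k, chiOf ω k = .left := fun h => by simpa [hs] using h (Fin.last n)
      have hright' : (∀ k, chiOf ω k = .right) → a = 1 ∧ b = 1 := fun h =>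
        hright fun k => h k.castSucc
      have hL : Commute (P.L b) (P.R p * Z (.inr j) * P.R q) :=
        ((P.commute_L_R b p).mul_right (hr j b).symm).mul_right (P.commute_L_R b q)
      by_cases h : ∃ j : Fin n, chiOf ω j.castSucc = chiOf ω (Fin.last n)
      · refine ⟨Fin.snoc (α := fun _ => B) c (p * b'), hsnoc _ (mul_mem hp hb'), a, ha, a', ha',
          b, hb, q, hq, hright', fun h => absurd h hnl, ?_⟩
        rw [normalProd_succ, normalEntry_last_of_exists _ _ h, hs, hω, Fin.snoc_last, ← hW,
          (P.commute_L_R b b').eq, (P.commute_L_R b q).eq]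
        simp only [BBSpace.C, mul_assoc, ← P.R_mul_R] at hL ⊢
        rw [hL.eq]
        simp only [mul_assoc]
      · push Not at h
        have hall : ∀ k : Fin n, chiOf (fun k => ω k.castSucc) k = .left := by
          intro k
          have := h k
          rw [hs] at this
          show chiOf ω k.castSucc = .left
          cases hk : chiOf ω k.castSucc
          · rfl
          · exact absurd hk this
        obtain ⟨rfl, rfl⟩ := hleft hall
        have hWR := commute_normalProd_R (P := P) (Z := Z) hl _ hall c p
        rw [← hW] at hWR
        refine ⟨Fin.snoc (α := fun _ => B) c 1, hsnoc _ (one_mem D), a, ha, p, hp,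
          b, hb, q, hq, hright', fun h => absurd h hnl, ?_⟩
        rw [normalProd_succ, normalEntry_last_of_forall _ _ h, hs, hω, ← hW,
          (P.commute_L_R b q).eq]
        simp only [BBSpace.C, P.R_one, one_mul, mul_one, mul_assoc] at hL ⊢
        rw [hL.eq, ← hWR.left_comm]
        simp only [mul_assoc]

open Classical in
/-- The arguments of `κ_{Z,ω}` realize every choice of decorations in normal form. -/
theorem exists_kappaArg_eq {D : Subalgebra ℂ B} {m : ℕ} (ω : Fin (m + 1) → I ⊕ J)
    {c : Fin (m + 1) → B} (hc : ∀ k, c k ∈ D) {e : B} (he : e ∈ D) :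
    ∃ d : Fin m → D, ∀ k, kappaArg P Z ω (fun i => (d i : B)) k =
      normalEntry P Z ω c k *
        if k = Fin.last m ∧ ∃ j, chiOf ω j ≠ chiOf ω 0 then P.C (chiOf ω k) e else 1 := by
  -- This inverts the numbering in `kappaArg`: `d i` belongs to node `i + 1` before the change of
  -- side and to node `i + 2` from then on, which skips the first node of the other side. An index
  -- past the last node is the trailing factor `e`.
  refine ⟨fun i => if ∀ j : Fin (m + 1), j.val ≤ i.val + 1 → chiOf ω j = chiOf ω 0 then
      ⟨c ⟨i.val + 1, by omega⟩, hc _⟩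
    else if h : i.val + 2 < m + 1 then ⟨c ⟨i.val + 2, h⟩, hc _⟩ else ⟨e, he⟩, fun k => ?_⟩
  unfold kappaArg normalEntry
  congr 1
  · congr 1
    by_cases h : ∃ j < k, chiOf ω j = chiOf ω k
    · rw [dif_pos h, if_pos h]
      congr 1
      obtain ⟨j, hj, hjk⟩ := h
      have hj' : j.val < k.val := hj
      have hk := k.isLt
      by_cases h' : ∃ j < k, chiOf ω j ≠ chiOf ω 0
      · obtain ⟨i, hi, hi'⟩ := id h'
        have hi0 : i.val ≠ 0 := fun h => hi' (congrArg (chiOf ω) (Fin.ext h))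
        have hik : i.val < k.val := hi
        have hval : k.val - 2 + 2 = k.val := by omega
        simp only [if_pos h']
        rw [if_neg fun h => hi' (h i (by omega)), dif_pos (by omega)]
        exact congrArg c (Fin.ext hval)
      · simp only [if_neg h']
        push Not at h'
        have hval : k.val - 1 + 1 = k.val := by omega
        rw [if_pos]
        · exact congrArg c (Fin.ext hval)
        · intro i hi
          rcases Nat.lt_or_ge i.val k.val with hik | hik
          · exact h' i hik
          · have : i = k := Fin.ext (by omega)
            rw [this, ← hjk]
            exact h' j hj
    · rw [dif_neg h, if_neg h]
  · by_cases h : k = Fin.last m ∧ ∃ j, chiOf ω j ≠ chiOf ω 0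
    · rw [dif_pos h, if_pos h]
      congr 1
      obtain ⟨-, j, hj⟩ := h
      have hjl := j.isLt
      have hj0 : j.val ≠ 0 := fun h => hj (congrArg (chiOf ω) (Fin.ext h))
      have hneg : ¬ ∀ i : Fin (m + 1), i.val ≤ m - 1 + 1 → chiOf ω i = chiOf ω 0 := fun h =>
        hj (h j (by omega))
      have hneg' : ¬ m - 1 + 2 < m + 1 := by omega
      simp only [if_neg hneg, dif_neg hneg']
    · rw [dif_neg h, if_neg h]

theorem prod_eq_normalProd_mul {m : ℕ} (ω : Fin (m + 1) → I ⊕ J) {c : Fin (m + 1) → B} {Y : Fin (m + 1) → A}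
    {x : A} (h : ∀ k, Y k = normalEntry P Z ω c k * if k = Fin.last m then x else 1) :
    (List.ofFn Y).prod = (List.ofFn (normalEntry P Z ω c)).prod * x := by
  rw [List.ofFn_succ', List.ofFn_succ']
  simp only [List.concat_eq_append, List.prod_append, List.prod_singleton, mul_assoc]
  rw [h, if_pos rfl]
  congr 3
  funext k
  rw [h, if_neg (Fin.castSucc_lt_last k).ne, mul_one]

/-- Up to factors in `D` at both ends, the moment of a product of decorated entries is the moment
of the arguments of some `κ_{Z,ω}(d_1, …, d_{n-1})`. -/
theorem exists_E_prod_eq {D : Subalgebra ℂ B}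
    (hl : ∀ i b, Commute (Z (.inl i)) (P.R b)) (hr : ∀ j b, Commute (Z (.inr j)) (P.L b))
    {m : ℕ} (ω : Fin (m + 1) → I ⊕ J) (X : Fin (m + 1) → A)
    (hX : ∀ k, IsDecorated P D (chiOf ω k) (Z (ω k)) (X k)) :
    ∃ d : Fin m → D, ∃ a ∈ D, ∃ a' ∈ D, P.E (List.ofFn X).prod =
      a * P.E (List.ofFn (kappaArg P Z ω fun i => (d i : B))).prod * a' := by
  obtain ⟨c, hc, a, ha, a', ha', b, hb, b', hb', hright, hleft, hprod⟩ :=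
    exists_normalProd hl hr ω X hX
  obtain ⟨d, hd⟩ := exists_kappaArg_eq (P := P) (Z := Z) ω hc (mul_mem hb hb')
  rw [hprod, P.E_L_mul, P.E_R_mul]
  set W := (List.ofFn (normalEntry P Z ω c)).prod with hW
  by_cases hmix : ∃ j, chiOf ω j ≠ chiOf ω 0
  · refine ⟨d, a, ha, a', ha', ?_⟩
    simp only [hmix, and_true] at hd
    rw [prod_eq_normalProd_mul ω (x := P.C (chiOf ω (Fin.last m)) (b * b')) (c := c), ← hW, mul_assoc]
    · congr 2
      -- Under `E` the final factor may be switched between `L` and `R`. Either way the two trailing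
      -- factors combine to `b * b'`.
      cases chiOf ω (Fin.last m)
      · rw [BBSpace.C, ← mul_assoc, ← P.E_mul_L, mul_assoc, P.L_mul_L]
      · rw [BBSpace.C, (P.commute_L_R b b').eq, ← mul_assoc, P.E_mul_L, mul_assoc, P.R_mul_R]
    · intro k
      rw [hd k]
      by_cases hk : k = Fin.last m
      · subst hk; rfl
      · simp [hk]
  · simp only [hmix, and_false, if_false, mul_one] at hd
    push Not at hmix
    cases h0 : chiOf ω 0
    · have hall : ∀ k, chiOf ω k = .left := fun k => (hmix k).trans h0
      obtain ⟨rfl, rfl⟩ := hleft hall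
      -- One-sided cumulants have no trailing slot: `E(W L_b) = E(W R_b) = E(R_b W) = E(W) b`.
      refine ⟨d, a, ha, b, hb, ?_⟩
      rw [funext hd, ← hW, P.R_one, mul_one, mul_one, P.E_mul_L,
        (commute_normalProd_R hl ω hall c b).eq, P.E_R_mul, mul_assoc]
    · have hall : ∀ k, chiOf ω k = .right := fun k => (hmix k).trans h0
      obtain ⟨rfl, rfl⟩ := hright hall
      refine ⟨d, b', hb', a', ha', ?_⟩
      rw [funext hd, ← hW, P.L_one, one_mul, one_mul, ← P.E_mul_L,
        (commute_normalProd_L hr ω hall c b').eq, P.E_L_mul]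

/-! ### Moments of decorated entries lie in the subalgebra -/

/-- Only `μ(1_χ, 1_χ) = 1` is needed to isolate the top term; no Möbius inversion takes place. -/
theorem E_prod_eq_cumulant_sub {m : ℕ} (χ : Fin m → Side) (X : Fin m → A) :
    P.E (List.ofFn X).prod = cumulant P χ (BNC.one χ) X -
      ∑ σ ∈ Finset.univ.erase (BNC.one χ), muBNC χ σ (BNC.one χ) • moment P χ σ X := by
  classical
  have hle : ∀ σ : BNC χ, σ ≤ BNC.one χ := fun σ => (le_top : σ.1 ≤ ⊤)
  rw [cumulant, Finset.filter_true_of_mem fun σ _ => hle σ, eq_sub_iff_add_eq,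
    ← Finset.add_sum_erase _ _ (Finset.mem_univ (BNC.one χ))]
  congr 1
  rw [muBNC, IncidenceAlgebra.mu_self, one_smul, moment, BNC.one, momentOn_top, orderedProd_univ]

theorem E_prod_mem {D : Subalgebra ℂ B}
    (hl : ∀ i b, Commute (Z (.inl i)) (P.R b)) (hr : ∀ j b, Commute (Z (.inr j)) (P.L b))
    (hD : ∀ (m : ℕ) (ω : Fin (m + 1) → I ⊕ J) (d : Fin m → D),
      kappa P Z ω (fun k => (d k : B)) ∈ D)
    (m : ℕ) (ω : Fin (m + 1) → I ⊕ J) (X : Fin (m + 1) → A)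
    (hX : ∀ k, IsDecorated P D (chiOf ω k) (Z (ω k)) (X k)) : P.E (List.ofFn X).prod ∈ D := by
  classical
  induction m using Nat.strong_induction_on with
  | _ m ih =>
  obtain ⟨d, a, ha, a', ha', h⟩ := exists_E_prod_eq hl hr ω X hX
  rw [h, E_prod_eq_cumulant_sub (chiOf ω)]
  refine mul_mem (mul_mem ha (sub_mem (hD m ω d) (sum_mem fun σ hσ => ?_))) ha'
  refine D.smul_mem (momentOn_mem (Y := fun k => Z (ω k)) ?_ _ Finset.univ_nonempty _ (Or.inr ?_) _
    (isDecorated_kappaArg Z ω fun i => (d i).2)) _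
  · intro X hX V hV hVu
    obtain ⟨N, hN⟩ : ∃ N, V.card = N + 1 := ⟨V.card - 1, by have := hV.card_pos; omega⟩
    -- A proper subset of the nodes, renumbered increasingly, is a shorter word to which the
    -- induction hypothesis applies.
    have hlt : V.card < m + 1 := by
      simpa using Finset.card_lt_card (Finset.ssubset_univ_iff.2 hVu)
    rw [orderedProd_eq_ofFn X V hN]
    exact ih N (by omega) (fun i => ω (V.orderEmbOfFin hN i)) _ fun k => hX _
  · exact fun h => (Finset.mem_erase.1 hσ).1 (Subtype.ext h)

theorem kappaArg_restrict {D : Subalgebra ℂ B} (F : CondExp D) {m : ℕ} (ω : Fin (m + 1) → I ⊕ J)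
    (d : Fin m → D) :
    kappaArg (P.restrict F) Z ω d = kappaArg P Z ω fun k => (d k : B) := by
  funext k
  simp only [kappaArg, BBSpace.restrict_C]

end

end

end BiFree

/-! ### Comparison of the `D`- and `B`-valued cumulants -/

theorem mainTheorem7 {B A I J : Type*} [Ring B] [Algebra ℂ B] [Ring A] [Algebra ℂ A]
    (P : BiFree.BBSpace B A) (D : Subalgebra ℂ B) (F : BiFree.CondExp D)
    (Zl : I → A) (Zr : J → A)
    (hZl : ∀ i, Zl i ∈ P.leftAlgebra) (hZr : ∀ j, Zr j ∈ P.rightAlgebra)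
    (hD : ∀ (m : ℕ) (ω : Fin (m + 1) → I ⊕ J) (d : Fin m → D),
      BiFree.kappa P (Sum.elim Zl Zr) ω (fun k => (d k : B)) ∈ D) :
    ∀ (m : ℕ) (ω : Fin (m + 1) → I ⊕ J) (d : Fin m → D),
      ((BiFree.kappa (P.restrict F) (Sum.elim Zl Zr) ω d : D) : B) =
        BiFree.kappa P (Sum.elim Zl Zr) ω (fun k => (d k : B)) := by
  intro m ω d
  have hl : ∀ i b, Commute (Sum.elim Zl Zr (.inl i)) (P.R b) := fun i b =>
    ((Subalgebra.mem_centralizer_iff ℂ).1 (hZl i) _ (Set.mem_range_self b)).symm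
  have hr : ∀ j b, Commute (Sum.elim Zl Zr (.inr j)) (P.L b) := fun j b =>
    ((Subalgebra.mem_centralizer_iff ℂ).1 (hZr j) _ (Set.mem_range_self b)).symm
  rw [BiFree.kappa, BiFree.kappa, BiFree.kappaArg_restrict, BiFree.cumulant, BiFree.cumulant,
    AddSubmonoidClass.coe_finsetSum]
  refine Finset.sum_congr rfl fun σ _ => ?_
  rw [SetLike.val_smul, BiFree.moment, BiFree.moment,
    BiFree.momentOn_restrict F (Y := fun k => Sum.elim Zl Zr (ω k)) ?_ _ Finset.univ_nonempty _ _
      (BiFree.isDecorated_kappaArg _ ω fun i => (d i).2)]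
  intro X hX V hV
  obtain ⟨N, hN⟩ : ∃ N, V.card = N + 1 := ⟨V.card - 1, by have := hV.card_pos; omega⟩
  rw [BiFree.orderedProd_eq_ofFn X V hN]
  exact BiFree.E_prod_mem hl hr hD N (fun i => ω (V.orderEmbOfFin hN i)) _ fun k => hX _
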